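/- Let $F$ be R. Thompson's group, i.e. the group (under composition) of all increasing piecewise linear homeomorphisms $f:[0,1]\to[0,1]$ having finitely many break points, such that all slopes of $f$ are integer powers of $2$ and all break points of $f$ lie in $\mathbb{Z}[\tfrac12]$. For a finite set $U\subset(0,1)$ let $H_U=\{f\in F : f(u)=u \text{ for all } u\in U\}$ be its stabilizer. If $U=\{\gamma_1<\gamma_2<\dots<\gamma_n\}$, the type $\tau(U)$ is the word of length $n$ in the alphabet $\{1,2,3\}$ whose $i$-th letter is $1$ if $\gamma_i\in\mathbb{Z}[\tfrac12]$, $2$ if $\gamma_i$ is rational but not in $\mathbb{Z}[\tfrac12]$, and $3$ if $\gamma_i$ is irrational. Theorem. Let $U$ and $V$ be finite subsets of $(0,1)$ such that $\tau(U)$ and $\tau(V)$ are equal letter by letter. Then the groups $H_U$ and $H_V$ are isomorphic. -/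

import Mathlib

namespace Thompson

open scoped unitInterval

/-- The dyadic numbers: `x` lies in `ℤ[1/2]`. -/
def IsDyadic (x : ℝ) : Prop := ∃ (m : ℤ) (n : ℕ), x = m / 2 ^ n

/-- An increasing self-homeomorphism `f` of `[0,1]` is a *Thompson map* if it is piecewise linear,
all slopes are (integer, possibly negative) powers of `2`, and the finitely many break points are
dyadic: there is a finite set `B` of dyadic points such that `f` is affine with slope a power of
`2` on every closed subinterval of `[0,1]` having no point of `B` in its interior. -/
def IsThompsonMap (f : I ≃o I) : Prop :=
  ∃ B : Finset I, (∀ b ∈ B, IsDyadic b) ∧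
    ∀ a b : I, a < b → (∀ c ∈ B, c ∉ Set.Ioo a b) →
      ∃ (k : ℤ) (d : ℝ), ∀ x ∈ Set.Icc a b, (f x : ℝ) = (2 : ℝ) ^ k * x + d

lemma IsDyadic.add {x y : ℝ} (hx : IsDyadic x) (hy : IsDyadic y) : IsDyadic (x + y) := by
  obtain ⟨m, n, rfl⟩ := hx
  obtain ⟨p, q, rfl⟩ := hy
  refine ⟨m * 2 ^ q + p * 2 ^ n, n + q, ?_⟩
  push_cast
  rw [pow_add]
  field_simp

lemma IsDyadic.neg {x : ℝ} (hx : IsDyadic x) : IsDyadic (-x) := by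
  obtain ⟨m, n, rfl⟩ := hx
  exact ⟨-m, n, by push_cast; ring⟩

lemma IsDyadic.sub {x y : ℝ} (hx : IsDyadic x) (hy : IsDyadic y) : IsDyadic (x - y) := by
  rw [sub_eq_add_neg]
  exact hx.add hy.neg

lemma isDyadic_zero : IsDyadic 0 := ⟨0, 0, by simp⟩

lemma IsDyadic.zpow_mul {x : ℝ} (hx : IsDyadic x) (k : ℤ) : IsDyadic ((2 : ℝ) ^ k * x) := by
  obtain ⟨m, n, rfl⟩ := hx
  obtain ⟨j, rfl | rfl⟩ := k.eq_nat_or_neg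
  · exact ⟨2 ^ j * m, n, by push_cast; rw [zpow_natCast]; ring⟩
  · refine ⟨m, n + j, ?_⟩
    rw [zpow_neg, zpow_natCast, pow_add]
    field_simp

lemma isDyadic_zpow_mul_iff {x : ℝ} (k : ℤ) : IsDyadic ((2 : ℝ) ^ k * x) ↔ IsDyadic x := by
  refine ⟨fun h => ?_, fun h => h.zpow_mul k⟩
  have := h.zpow_mul (-k)
  rwa [← mul_assoc, ← zpow_add₀ (by norm_num), neg_add_cancel, zpow_zero, one_mul] at this

/-- A Thompson map preserves dyadic numbers in both directions. -/
lemma IsThompsonMap.isDyadic_iff {f : I ≃o I} (hf : IsThompsonMap f) (x : I) :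
    IsDyadic (f x) ↔ IsDyadic x := by
  obtain ⟨B, hB, hfB⟩ := hf
  have key : ∀ (n : ℕ) (x : I), (B.filter (· < x)).card = n →
      (IsDyadic (f x) ↔ IsDyadic x) := by
    intro n
    induction n using Nat.strong_induction_on with
    | _ n ih =>
      intro x hx
      have step : ∀ a : I, a < x → (∀ c ∈ B, c ∉ Set.Ioo a x) → IsDyadic a → IsDyadic (f a) →
          (IsDyadic (f x) ↔ IsDyadic x) := by
        intro a hax hc ha hfa
        obtain ⟨k, d, h⟩ := hfB a x hax hc
        have h1 := h a ⟨le_rfl, hax.le⟩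
        have h2 := h x ⟨hax.le, le_rfl⟩
        have h3 : (f x : ℝ) - f a = (2 : ℝ) ^ k * ((x : ℝ) - a) := by rw [h1, h2]; ring
        constructor
        · intro hfx
          have h4 := hfx.sub hfa
          rw [h3, isDyadic_zpow_mul_iff] at h4
          simpa using h4.add ha
        · intro hx'
          have h4 := (hx'.sub ha).zpow_mul k
          rw [← h3] at h4
          simpa using h4.add hfa
      have hf0 : f 0 = 0 := map_bot f
      rcases (B.filter (· < x)).eq_empty_or_nonempty with he | hne
      · rcases eq_or_lt_of_le (show (0 : I) ≤ x from bot_le) with h0 | h0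
        · rw [← h0, hf0]
        · refine step 0 h0 (fun c hc hcx => ?_) (by simpa using isDyadic_zero)
            (by rw [hf0]; simpa using isDyadic_zero)
          have : c ∈ B.filter (· < x) := Finset.mem_filter.2 ⟨hc, hcx.2⟩
          rw [he] at this
          simp at this
      · have hm := Finset.max'_mem _ hne
        set a := (B.filter (· < x)).max' hne with ha
        obtain ⟨haB, hax⟩ := Finset.mem_filter.1 hm
        have hlt : (B.filter (· < a)).card < n := by
          rw [← hx]
          apply Finset.card_lt_card
          rw [Finset.ssubset_iff_of_subset]
          · exact ⟨a, hm, by simp⟩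
          · intro c hc
            rw [Finset.mem_filter] at hc ⊢
            exact ⟨hc.1, hc.2.trans hax⟩
        refine step a hax (fun c hc hcx => ?_) (hB a haB) ((ih _ hlt a rfl).2 (hB a haB))
        have := Finset.le_max' (B.filter (· < x)) c (Finset.mem_filter.2 ⟨hc, hcx.2⟩)
        exact absurd hcx.1 (not_lt.2 this)
  exact key _ x rfl

lemma IsThompsonMap.one : IsThompsonMap 1 :=
  ⟨∅, by simp, fun _ _ _ _ => ⟨0, 0, fun x _ => by simp⟩⟩

lemma IsThompsonMap.inv {f : I ≃o I} (hf : IsThompsonMap f) : IsThompsonMap f⁻¹ := by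
  have hd := hf.isDyadic_iff
  obtain ⟨B, hB, h⟩ := hf
  have hi : ∀ x, f (f⁻¹ x) = x := fun x => f.apply_symm_apply x
  have hi' : ∀ x, f⁻¹ (f x) = x := fun x => f.symm_apply_apply x
  have hlt : StrictMono (f⁻¹ : I ≃o I) := OrderIso.strictMono _
  refine ⟨B.image f, ?_, ?_⟩
  · intro b hb
    obtain ⟨c, hc, rfl⟩ := Finset.mem_image.1 hb
    exact (hd c).2 (hB c hc)
  · intro a b hab hc
    obtain ⟨k, d, hk⟩ := h (f⁻¹ a) (f⁻¹ b) (hlt hab) (fun c hcB hcI =>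
      hc (f c) (Finset.mem_image_of_mem f hcB)
        ⟨by simpa [hi] using f.strictMono hcI.1, by simpa [hi] using f.strictMono hcI.2⟩)
    refine ⟨-k, -((2 : ℝ) ^ (-k) * d), fun x hx => ?_⟩
    have h1 := hk (f⁻¹ x) ⟨hlt.monotone hx.1, hlt.monotone hx.2⟩
    rw [hi] at h1
    have h2 : (2 : ℝ) ^ (-k) * (2 : ℝ) ^ k = 1 := by
      rw [← zpow_add₀ (by norm_num), neg_add_cancel, zpow_zero]
    rw [h1, mul_add, ← mul_assoc, h2]
    ring

lemma IsThompsonMap.mul {f g : I ≃o I} (hf : IsThompsonMap f) (hg : IsThompsonMap g) :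
    IsThompsonMap (f * g) := by
  have hd := hg.inv.isDyadic_iff
  obtain ⟨B, hB, h⟩ := hf
  obtain ⟨C, hC, h'⟩ := hg
  refine ⟨C ∪ B.image ⇑(g⁻¹), ?_, ?_⟩
  · intro b hb
    rcases Finset.mem_union.1 hb with hb | hb
    · exact hC b hb
    · obtain ⟨c, hc, rfl⟩ := Finset.mem_image.1 hb
      exact (hd c).2 (hB c hc)
  · intro a b hab hc
    obtain ⟨k, d, hk⟩ := h' a b hab (fun c hcC => hc c (Finset.mem_union_left _ hcC))
    obtain ⟨l, e, hl⟩ := h (g a) (g b) (g.strictMono hab) (fun c hcB hcI => by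
      refine hc (g⁻¹ c) (Finset.mem_union_right _ (Finset.mem_image_of_mem _ hcB)) ⟨?_, ?_⟩
      · exact (g.lt_symm_apply).2 hcI.1
      · exact (g.symm_apply_lt).2 hcI.2)
    refine ⟨l + k, (2 : ℝ) ^ l * d + e, fun x hx => ?_⟩
    have h1 := hl (g x) ⟨g.monotone hx.1, g.monotone hx.2⟩
    rw [hk x hx] at h1
    rw [RelIso.mul_apply, h1, zpow_add₀ (by norm_num)]
    ring

/-- R. Thompson's group `F`, as a subgroup of the group of increasing self-homeomorphisms
(equivalently, order automorphisms) of `[0,1]`. -/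
def F : Subgroup (I ≃o I) where
  carrier := {f | IsThompsonMap f}
  one_mem' := IsThompsonMap.one
  mul_mem' := IsThompsonMap.mul
  inv_mem' := IsThompsonMap.inv

/-- The stabilizer `H_U ≤ F` of a finite set `U` of real numbers: all `f ∈ F` fixing every point
of `U ∩ [0,1]`. Elements of `F` are increasing, so for finite `U ⊆ [0,1]` the
pointwise and the setwise stabilizers coincide. -/
def H (U : Finset ℝ) : Subgroup F where
  carrier := {f | ∀ x : I, (x : ℝ) ∈ U → f.1 x = x}
  one_mem' := fun _ _ => rfl
  mul_mem' := fun {f g} hf hg x hx => by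
    rw [Subgroup.coe_mul, RelIso.mul_apply, hg x hx, hf x hx]
  inv_mem' := fun {f} hf x hx => by
    have h := congrArg (f.1.symm) (hf x hx)
    rw [OrderIso.symm_apply_apply] at h
    exact h.symm

open Classical in
/-- The letter of a real number: `1` if it is dyadic, `2` if it is rational but not dyadic,
`3` if it is irrational. -/
noncomputable def letter (x : ℝ) : ℕ :=
  if IsDyadic x then 1 else if Irrational x then 3 else 2

/-- The type `τ(U)`: the word in the alphabet `{1,2,3}` whose `i`-th letter is the letter of the
`i`-th element of `U` in increasing order. -/
noncomputable def τ (U : Finset ℝ) : List ℕ :=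
  (U.sort (· ≤ ·)).map letter

end Thompson

/-! The isomorphism is conjugation by a homeomorphism `Φ` of the line that carries `U` to `V` and
fixes 0 and 1. `Φ` need not be piecewise linear with finitely many pieces: its breaks may accumulate
at the non-dyadic points of `U`. Elsewhere it is locally piecewise dyadic affine with dyadic breaks
(`Good`), and at a non-dyadic `γ` in `U` it only has to match the germs of dyadic affine maps fixing
`γ` with those fixing `Φ γ` (`Compat`).

This suffices because an element of `F` has no break at a non-dyadic point: if it fixes `γ`, its
germ there is a homothety with ratio a power of 2. For irrational `γ` that germ is trivial
(`eq_one_of_irrational`); for rational `γ` the possible germs form an infinite cyclic group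
(`exists_generator_of_rational`). Hence only the letter of `γ` matters. In the rational case `Φ` is
built by matching fundamental domains of the two generators and extending equivariantly
(`leftConj_homothety`); in the irrational case any matching of dyadic cells works (`leftConj_one`).

The local maps are joined inside the gaps (`exists_connect`), since good maps act transitively on
increasing dyadic pairs. The conjugate of an element of `H_U` is then good everywhere on [0,1], so
by compactness it lies in `F` (`IsThompsonMap.of_good`). -/

namespace Thompson

open scoped unitInterval
open Filter Topology

/-! ### Dyadic affine maps of the line -/

/-- The order automorphism `x ↦ 2 ^ k * x + d` of the real line. -/
noncomputable def affineIso (k : ℤ) (d : ℝ) : ℝ ≃o ℝ :=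
  (OrderIso.mulLeft₀ ((2 : ℝ) ^ k) (by positivity)).trans (OrderIso.addRight d)

@[simp] lemma affineIso_apply (k : ℤ) (d x : ℝ) : affineIso k d x = 2 ^ k * x + d := rfl

/-- The group of dyadic affine maps `x ↦ 2 ^ k * x + d`, `d` dyadic. -/
def dyadicAffine : Subgroup (ℝ ≃o ℝ) where
  carrier := {A | ∃ (k : ℤ) (d : ℝ), IsDyadic d ∧ A = affineIso k d}
  one_mem' := ⟨0, 0, isDyadic_zero, by ext; simp⟩
  mul_mem' := by
    rintro _ _ ⟨k, d, hd, rfl⟩ ⟨l, e, he, rfl⟩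
    refine ⟨k + l, 2 ^ k * e + d, (he.zpow_mul k).add hd, ?_⟩
    ext x
    rw [RelIso.mul_apply]
    simp only [affineIso_apply]
    rw [zpow_add₀ (by norm_num)]
    ring
  inv_mem' := by
    rintro _ ⟨k, d, hd, rfl⟩
    refine ⟨-k, -(2 ^ (-k) * d), (hd.zpow_mul _).neg, inv_eq_of_mul_eq_one_left ?_⟩
    ext x
    rw [RelIso.mul_apply]
    simp only [affineIso_apply, RelIso.coe_one, id]
    have : (2 : ℝ) ^ (-k) * 2 ^ k = 1 := by rw [← zpow_add₀ (by norm_num)]; simp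
    linear_combination x * this

lemma affineIso_mem (k : ℤ) {d : ℝ} (hd : IsDyadic d) : affineIso k d ∈ dyadicAffine :=
  ⟨k, d, hd, rfl⟩

lemma isDyadic_apply_iff {A : ℝ ≃o ℝ} (hA : A ∈ dyadicAffine) (x : ℝ) :
    IsDyadic (A x) ↔ IsDyadic x := by
  obtain ⟨k, d, hd, rfl⟩ := hA
  rw [affineIso_apply]
  refine ⟨fun h => ?_, fun h => (h.zpow_mul k).add hd⟩
  have := h.sub hd
  rwa [add_sub_cancel_right, isDyadic_zpow_mul_iff] at this

lemma dyadicAffine_ext {A B : ℝ ≃o ℝ} (hA : A ∈ dyadicAffine) (hB : B ∈ dyadicAffine) {x y : ℝ}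
    (hxy : x ≠ y) (hx : A x = B x) (hy : A y = B y) : A = B := by
  obtain ⟨k, d, hd, rfl⟩ := hA
  obtain ⟨l, e, he, rfl⟩ := hB
  simp only [affineIso_apply] at hx hy
  have h1 : ((2 : ℝ) ^ k - 2 ^ l) * (x - y) = 0 := by linear_combination hx - hy
  have h2 : (2 : ℝ) ^ k = 2 ^ l :=
    sub_eq_zero.1 ((mul_eq_zero.1 h1).resolve_right (sub_ne_zero.2 hxy))
  have h3 : d = e := by rw [h2] at hx; linarith
  ext z
  simp [h2, h3]

/-! ### Local dyadic affine structure -/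

section Good

variable {α : Type*} [LinearOrder α] [TopologicalSpace α] (c : α → ℝ)

/-- In the coordinate `c`, the map `f` is dyadic affine on both sides of `x`, with a break only if
`x` is dyadic. -/
def Good (f : α ≃o α) (x : α) : Prop :=
  ∃ A ∈ dyadicAffine, ∃ B ∈ dyadicAffine,
    (∀ᶠ y in 𝓝[≤] x, c (f y) = A (c y)) ∧ (∀ᶠ y in 𝓝[≥] x, c (f y) = B (c y)) ∧
    (IsDyadic (c x) ∨ A = B)

variable {c}

lemma tendsto_orderIso_nhdsLE [OrderTopology α] (f : α ≃o α) (x : α) : Tendsto f (𝓝[≤] x) (𝓝[≤] (f x)) :=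
  f.continuous.continuousWithinAt.tendsto_nhdsWithin fun _ hy => f.monotone hy

lemma tendsto_orderIso_nhdsGE [OrderTopology α] (f : α ≃o α) (x : α) : Tendsto f (𝓝[≥] x) (𝓝[≥] (f x)) :=
  f.continuous.continuousWithinAt.tendsto_nhdsWithin fun _ hy => f.monotone hy

lemma Good.isDyadic_iff {f : α ≃o α} {x : α} (h : Good c f x) :
    IsDyadic (c (f x)) ↔ IsDyadic (c x) := by
  obtain ⟨A, hA, B, hB, h1, h2, h3⟩ := h
  rw [h1.self_of_nhdsWithin le_rfl]
  exact isDyadic_apply_iff hA _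

lemma Good.mul [OrderTopology α] {f g : α ≃o α} {x : α} (hg : Good c g (f x)) (hf : Good c f x) :
    Good c (g * f) x := by
  have hd := hf.isDyadic_iff
  obtain ⟨A, hA, B, hB, h1, h2, h3⟩ := hf
  obtain ⟨A', hA', B', hB', h1', h2', h3'⟩ := hg
  refine ⟨A' * A, mul_mem hA' hA, B' * B, mul_mem hB' hB, ?_, ?_, ?_⟩
  · filter_upwards [h1, (tendsto_orderIso_nhdsLE f x).eventually h1'] with y hy hy'
    rw [RelIso.mul_apply, RelIso.mul_apply, hy', hy]
  · filter_upwards [h2, (tendsto_orderIso_nhdsGE f x).eventually h2'] with y hy hy'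
    rw [RelIso.mul_apply, RelIso.mul_apply, hy', hy]
  -- A break of `g` at `f x` forces `f x`, hence `x`, to be dyadic.
  · rw [hd] at h3'
    rcases h3 with h | rfl
    · exact .inl h
    · rcases h3' with h | rfl
      · exact .inl h
      · exact .inr rfl

lemma Good.inv [OrderTopology α] {f : α ≃o α} {x : α} (hf : Good c f x) : Good c f⁻¹ (f x) := by
  have hd := hf.isDyadic_iff
  obtain ⟨A, hA, B, hB, h1, h2, h3⟩ := hf
  have hx : f⁻¹ (f x) = x := f.symm_apply_apply x
  have hi : ∀ y, f (f⁻¹ y) = y := f.apply_symm_apply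
  have hl := tendsto_orderIso_nhdsLE f⁻¹ (f x)
  have hr := tendsto_orderIso_nhdsGE f⁻¹ (f x)
  rw [hx] at hl hr
  refine ⟨A⁻¹, inv_mem hA, B⁻¹, inv_mem hB, ?_, ?_, ?_⟩
  · filter_upwards [hl.eventually h1] with y hy
    rw [hi] at hy
    rw [hy]
    exact (A.symm_apply_apply _).symm
  · filter_upwards [hr.eventually h2] with y hy
    rw [hi] at hy
    rw [hy]
    exact (B.symm_apply_apply _).symm
  · rw [hd, inv_inj]
    exact h3

lemma Good.congr {f g : α ≃o α} {x : α} (hg : Good c g x) (h : ∀ᶠ y in 𝓝 x, f y = g y) :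
    Good c f x := by
  obtain ⟨A, hA, B, hB, h1, h2, h3⟩ := hg
  refine ⟨A, hA, B, hB, ?_, ?_, h3⟩
  · filter_upwards [h1, h.filter_mono nhdsWithin_le_nhds] with y hy hy'
    rw [hy', hy]
  · filter_upwards [h2, h.filter_mono nhdsWithin_le_nhds] with y hy hy'
    rw [hy', hy]

/-- At a dyadic point a break is free, so the two one-sided germs may come from different good maps.
This is why all cutting is done at dyadic points. -/
lemma Good.glue {f g h : α ≃o α} {x : α} (hf : Good c f x) (hg : Good c g x)
    (hx : IsDyadic (c x)) (hl : ∀ᶠ y in 𝓝[≤] x, h y = f y) (hr : ∀ᶠ y in 𝓝[≥] x, h y = g y) :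
    Good c h x := by
  obtain ⟨A, hA, -, -, h1, -, -⟩ := hf
  obtain ⟨-, -, B, hB, -, h2, -⟩ := hg
  refine ⟨A, hA, B, hB, ?_, ?_, .inl hx⟩
  · filter_upwards [h1, hl] with y hy hy'
    rw [hy', hy]
  · filter_upwards [h2, hr] with y hy hy'
    rw [hy', hy]

end Good

/-! ### Good automorphisms, gluing, and transitivity on dyadic pairs -/

lemma good_of_mem {A : ℝ ≃o ℝ} (hA : A ∈ dyadicAffine) (x : ℝ) : Good id A x :=
  ⟨A, hA, A, hA, by simp, by simp, .inr rfl⟩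

/-- The everywhere good automorphisms of the line: locally finite piecewise dyadic affine maps. -/
def goodGroup : Subgroup (ℝ ≃o ℝ) where
  carrier := {f | ∀ x, Good id f x}
  one_mem' := good_of_mem (one_mem _)
  mul_mem' := fun hf hg x => (hf _).mul (hg x)
  inv_mem' := fun {f} hf x => by
    have := (hf (f⁻¹ x)).inv
    rwa [show f (f⁻¹ x) = x from f.apply_symm_apply x] at this

lemma dyadicAffine_le_goodGroup : dyadicAffine ≤ goodGroup := fun _ hA x => good_of_mem hA x

/-- Gluing automorphisms of the line along two partitions into cells that are indexed by monotone
labels. -/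
lemma exists_orderIso_of_cells {ι : Type*} [PartialOrder ι] {ν ν' : ℝ → ι} (hν : Monotone ν)
    (hν' : Monotone ν') (θ : ι → ℝ ≃o ℝ) (h : ∀ i x, ν' (θ i x) = i ↔ ν x = i) :
    ∃ Φ : ℝ ≃o ℝ, ∀ x, Φ x = θ (ν x) x := by
  have hmono : StrictMono fun x => θ (ν x) x := by
    intro x y hxy
    rcases (hν hxy.le).eq_or_lt with he | hlt
    · simp only [he]
      exact (θ _).strictMono hxy
    -- By `h`, the image of `x` carries the same label as `x`, so a reversal of order would
    -- contradict monotonicity of `ν'`.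
    · by_contra hle
      have := hν' (not_lt.1 hle)
      simp only [(h _ _).2 rfl] at this
      exact (hlt.trans_le this).false
  have hsurj : Function.Surjective fun x => θ (ν x) x := by
    intro y
    have hx : ν ((θ (ν' y)).symm y) = ν' y := (h _ _).1 (by simp)
    exact ⟨(θ (ν' y)).symm y, by simp [hx]⟩
  exact ⟨hmono.orderIsoOfSurjective _ hsurj, fun _ => rfl⟩

lemma exists_orderIso_glue {f g : ℝ ≃o ℝ} {a : ℝ} (h : f a = g a) :
    ∃ Φ : ℝ ≃o ℝ, (∀ x ≤ a, Φ x = f x) ∧ ∀ x, a ≤ x → Φ x = g x := by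
  classical
  -- The labels are propositions ordered by implication, which gives two cells.
  obtain ⟨Φ, hΦ⟩ := exists_orderIso_of_cells (ν := fun x => a ≤ x) (ν' := fun y => f a ≤ y)
    (fun x y hxy h => le_trans h hxy) (fun x y hxy h => le_trans h hxy)
    (fun p => if p then g else f) (by
      intro p x
      by_cases hp : p
      · simp [hp, h]
      · simp [hp])
  refine ⟨Φ, fun x hx => ?_, fun x hx => by rw [hΦ, if_pos hx]⟩
  rw [hΦ]
  rcases hx.eq_or_lt with rfl | hx
  · simp [h]
  · rw [if_neg (not_le.2 hx)]

lemma exists_glue_mem_goodGroup {f g : ℝ ≃o ℝ} (hf : f ∈ goodGroup) (hg : g ∈ goodGroup) {a : ℝ}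
    (ha : IsDyadic a) (h : f a = g a) :
    ∃ Φ ∈ goodGroup, (∀ x ≤ a, Φ x = f x) ∧ ∀ x, a ≤ x → Φ x = g x := by
  obtain ⟨Φ, h1, h2⟩ := exists_orderIso_glue h
  refine ⟨Φ, fun x => ?_, h1, h2⟩
  rcases lt_trichotomy x a with hx | rfl | hx
  · exact (hf x).congr ((eventually_lt_nhds hx).mono fun y hy => h1 y hy.le)
  · exact (hf x).glue (hg x) ha (eventually_mem_nhdsWithin.mono fun y hy => h1 y hy)
      (eventually_mem_nhdsWithin.mono fun y hy => h2 y hy)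
  · exact (hg x).congr ((eventually_gt_nhds hx).mono fun y hy => h2 y hy.le)

/-- A ratio that is not a power of 2 is reached by breaking: the map that doubles up to 1 and
translates by 1 beyond fixes 0 and sends `m + 1` to `m + 2`. -/
lemma exists_goodGroup_natCast (m : ℕ) :
    ∃ f ∈ goodGroup, f 0 = 0 ∧ f 1 = ((m + 1 : ℕ) : ℝ) := by
  induction m with
  | zero => exact ⟨1, one_mem _, by simp, by simp⟩
  | succ m ih =>
    obtain ⟨f, hf, h0, h1⟩ := ih
    obtain ⟨g, hg, hl, hr⟩ := exists_glue_mem_goodGroup (a := 1)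
      (dyadicAffine_le_goodGroup (affineIso_mem 1 isDyadic_zero))
      (dyadicAffine_le_goodGroup (affineIso_mem 0 (d := 1) ⟨1, 0, by simp⟩))
      ⟨1, 0, by simp⟩ (by norm_num)
    refine ⟨g * f, mul_mem hg hf, ?_, ?_⟩
    · rw [RelIso.mul_apply, h0, hl _ (by norm_num)]
      simp
    · rw [RelIso.mul_apply, h1, hr _ (by simp)]
      simp

lemma exists_goodGroup_of_pos {q : ℝ} (hq : IsDyadic q) (hpos : 0 < q) :
    ∃ f ∈ goodGroup, f 0 = 0 ∧ f 1 = q := by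
  obtain ⟨m, n, rfl⟩ := hq
  have hm : 0 < m := by
    have := (div_pos_iff_of_pos_right (by positivity : (0 : ℝ) < 2 ^ n)).1 hpos
    exact_mod_cast this
  obtain ⟨f, hf, h0, h1⟩ := exists_goodGroup_natCast (m.toNat - 1)
  refine ⟨affineIso (-n) 0 * f,
    mul_mem (dyadicAffine_le_goodGroup (affineIso_mem _ isDyadic_zero)) hf, ?_, ?_⟩
  · rw [RelIso.mul_apply, h0]
    simp
  · rw [RelIso.mul_apply, h1, affineIso_apply, zpow_neg, zpow_natCast]
    have h2 : ((m.toNat - 1 + 1 : ℕ) : ℝ) = m := by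
      have : ((m.toNat - 1 + 1 : ℕ) : ℤ) = m := by omega
      exact_mod_cast this
    rw [h2]
    ring

/-- Good automorphisms of the line act transitively on increasing pairs of dyadic numbers. -/
lemma exists_goodGroup_pair {p q p' q' : ℝ} (hp : IsDyadic p) (hq : IsDyadic q)
    (hp' : IsDyadic p') (hq' : IsDyadic q') (hpq : p < q) (hpq' : p' < q') :
    ∃ f ∈ goodGroup, f p = p' ∧ f q = q' := by
  obtain ⟨f, hf, f0, f1⟩ := exists_goodGroup_of_pos (hq.sub hp) (sub_pos.2 hpq)
  obtain ⟨g, hg, g0, g1⟩ := exists_goodGroup_of_pos (hq'.sub hp') (sub_pos.2 hpq')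
  have hs : ∀ y z, f y = z → f⁻¹ z = y := by
    rintro y _ rfl
    exact f.symm_apply_apply y
  refine ⟨affineIso 0 p' * g * f⁻¹ * affineIso 0 (-p), mul_mem (mul_mem (mul_mem
    (dyadicAffine_le_goodGroup (affineIso_mem _ hp')) hg) (inv_mem hf))
    (dyadicAffine_le_goodGroup (affineIso_mem _ hp.neg)), ?_, ?_⟩
  · simp only [RelIso.mul_apply]
    rw [hs 0 _ (by rw [f0]; simp), g0]
    simp
  · simp only [RelIso.mul_apply]
    rw [hs 1 _ (by rw [f1]; simp; ring), g1]
    simp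

/-! ### Infinite gluing along sequences converging to a point -/

/-- `a` is an increasing two-sided sequence that is unbounded below and tends to `γ`. -/
structure IsExhaustion (a : ℤ → ℝ) (γ : ℝ) : Prop where
  strictMono : StrictMono a
  lt : ∀ n, a n < γ
  exists_gt : ∀ x < γ, ∃ n, x < a n
  exists_le : ∀ x, ∃ n, a n ≤ x

lemma IsExhaustion.of_bounds {a : ℤ → ℝ} {γ r C c : ℝ} (ha : StrictMono a) (hr : 1 < r)
    (hC : 0 < C) (hc : 0 < c) (hl : ∀ n, γ - C * r ^ (-n) ≤ a n)
    (hu : ∀ n, a n ≤ γ - c * r ^ (-n)) : IsExhaustion a γ where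
  strictMono := ha
  lt n := (hu n).trans_lt (by have := zpow_pos (zero_lt_one.trans hr) (-n); nlinarith)
  exists_gt x hx := by
    obtain ⟨n, hn⟩ := exists_pow_lt_of_lt_one (div_pos (sub_pos.2 hx) hC) (inv_lt_one_of_one_lt₀ hr)
    refine ⟨n, lt_of_lt_of_le ?_ (hl n)⟩
    rw [lt_div_iff₀ hC, inv_pow] at hn
    rw [zpow_neg, zpow_natCast]
    linarith
  exists_le x := by
    obtain ⟨n, hn⟩ := pow_unbounded_of_one_lt ((γ - x) / c) hr
    refine ⟨-n, (hu _).trans ?_⟩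
    rw [div_lt_iff₀ hc] at hn
    rw [neg_neg, zpow_natCast]
    linarith

lemma IsExhaustion.exists_cell {a : ℤ → ℝ} {γ x : ℝ} (ha : IsExhaustion a γ) (hx : x < γ) :
    ∃ n, a n ≤ x ∧ x < a (n + 1) := by
  obtain ⟨m, hm⟩ := ha.exists_gt x hx
  obtain ⟨n, hn, hmax⟩ := Int.exists_greatest_of_bdd (P := fun n => a n ≤ x)
    ⟨m, fun z hz => (ha.strictMono.lt_iff_lt.1 (hz.trans_lt hm)).le⟩ (ha.exists_le x)
  refine ⟨n, hn, not_le.1 fun h => ?_⟩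
  have := hmax _ h
  omega

/-- The label is the index of the cell containing `x`; the value `⊤` collects the ray from `γ` on,
so that labels stay monotone on the whole line. -/
lemma IsExhaustion.exists_label {a : ℤ → ℝ} {γ : ℝ} (ha : IsExhaustion a γ) :
    ∃ ν : ℝ → WithTop ℤ, Monotone ν ∧ (∀ x, ν x = ⊤ ↔ γ ≤ x) ∧
      ∀ x (n : ℤ), ν x = n ↔ a n ≤ x ∧ x < a (n + 1) := by
  classical
  have le_of : ∀ {x y n m}, x ≤ y → a n ≤ x → y < a (m + 1) → n ≤ m := by
    intro x y n m hxy h1 h2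
    have := ha.strictMono.lt_iff_lt.1 ((h1.trans hxy).trans_lt h2)
    omega
  choose! k hk1 hk2 using fun x (hx : x < γ) => ha.exists_cell hx
  refine ⟨fun x => if x < γ then (k x : WithTop ℤ) else ⊤, ?_, ?_, ?_⟩
  · intro x y hxy
    by_cases hy : y < γ
    · simp only [hy, hxy.trans_lt hy, if_true]
      exact WithTop.coe_le_coe.2 (le_of hxy (hk1 _ (hxy.trans_lt hy)) (hk2 _ hy))
    · simp [hy]
  · intro x
    by_cases hx : x < γ
    · simp [hx]
    · simp [hx, not_lt.1 hx]
  · intro x n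
    by_cases hx : x < γ
    · simp only [hx, if_true, WithTop.coe_inj]
      constructor
      · rintro rfl
        exact ⟨hk1 x hx, hk2 x hx⟩
      · rintro ⟨h1, h2⟩
        exact le_antisymm (le_of le_rfl (hk1 x hx) h2) (le_of le_rfl h1 (hk2 x hx))
    · simp only [hx, if_false, WithTop.top_ne_coe, false_iff, not_and, not_lt]
      exact fun _ => (ha.lt _).le.trans (not_lt.1 hx)

/-- Infinite gluing of good automorphisms along dyadic sequences increasing to `γ`, `γ'`. -/
lemma exists_glue_exhaustion {a a' : ℤ → ℝ} {γ γ' : ℝ} (ha : IsExhaustion a γ)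
    (ha' : IsExhaustion a' γ') (hd : ∀ n, IsDyadic (a n)) (θ : ℤ → ℝ ≃o ℝ)
    (hθ : ∀ n, θ n ∈ goodGroup) (h1 : ∀ n, θ n (a n) = a' n)
    (h2 : ∀ n, θ n (a (n + 1)) = a' (n + 1)) :
    ∃ Φ : ℝ ≃o ℝ, Φ γ = γ' ∧ (∀ x < γ, Good id Φ x) ∧
      ∀ n, ∀ x, a n ≤ x → x ≤ a (n + 1) → Φ x = θ n x := by
  obtain ⟨ν, hν, hνt, hνn⟩ := ha.exists_label
  obtain ⟨ν', hν', hνt', hνn'⟩ := ha'.exists_label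
  obtain ⟨Φ, hΦ⟩ := exists_orderIso_of_cells hν hν'
    -- To the right of `γ` the translation is only a filler; what matters there is that `γ` goes to
    -- `γ'`.
    (fun i => i.recTopCoe (affineIso 0 (γ' - γ)) θ) (by
      intro i x
      induction i with
      | top =>
        rw [hνt, hνt']
        simp only [WithTop.recTopCoe_top, affineIso_apply, zpow_zero, one_mul]
        constructor <;> intro _ <;> linarith
      | coe n =>
        rw [hνn, hνn', ← h1 n, ← h2 n]
        simp)
  have hcell : ∀ n x, a n ≤ x → x < a (n + 1) → Φ x = θ n x := by
    intro n x hx hx'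
    rw [hΦ, (hνn x n).2 ⟨hx, hx'⟩]
    rfl
  have hcell' : ∀ n x, a n ≤ x → x ≤ a (n + 1) → Φ x = θ n x := by
    intro n x hx hx'
    rcases hx'.eq_or_lt with rfl | h
    · rw [hcell (n + 1) _ le_rfl (ha.strictMono (by omega)), h1, h2]
    · exact hcell n x hx h
  refine ⟨Φ, ?_, ?_, hcell'⟩
  · rw [hΦ, (hνt γ).2 le_rfl]
    simp
  · intro x hx
    obtain ⟨n, hx1, hx2⟩ := ha.exists_cell hx
    rcases hx1.eq_or_lt with rfl | hx1
    -- At the dyadic endpoint `a n` the maps of the two adjacent cells meet.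
    · refine (hθ (n - 1) _).glue (hθ n _) (hd n) ?_ ?_
      · filter_upwards [eventually_mem_nhdsWithin,
          nhdsWithin_le_nhds (eventually_ge_nhds (ha.strictMono (sub_one_lt n)))] with y hy hy'
        exact hcell' _ y hy' (by simpa using hy)
      · filter_upwards [eventually_mem_nhdsWithin,
          nhdsWithin_le_nhds (eventually_le_nhds hx2)] with y hy hy'
        exact hcell' _ y hy hy'
    · refine (hθ n x).congr ?_
      filter_upwards [eventually_ge_nhds hx1, eventually_le_nhds hx2] with y hy hy'
      exact hcell' n y hy hy'

/-! ### Reflection and two-sided conjugacies -/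

/-- The conjugate of an automorphism of the line by `x ↦ -x`. -/
def reflect (f : ℝ ≃o ℝ) : ℝ ≃o ℝ where
  toFun x := -f (-x)
  invFun x := -f.symm (-x)
  left_inv x := by simp
  right_inv x := by simp
  map_rel_iff' := by simp

@[simp] lemma reflect_apply (f : ℝ ≃o ℝ) (x : ℝ) : reflect f x = -f (-x) := rfl

lemma reflect_mem {A : ℝ ≃o ℝ} (hA : A ∈ dyadicAffine) : reflect A ∈ dyadicAffine := by
  obtain ⟨k, d, hd, rfl⟩ := hA
  exact ⟨k, -d, hd.neg, by ext x; simp; ring⟩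

lemma Good.reflect {f : ℝ ≃o ℝ} {x : ℝ} (hf : Good id f (-x)) : Good id (reflect f) x := by
  obtain ⟨A, hA, B, hB, h1, h2, h3⟩ := hf
  have tr : Tendsto (fun y : ℝ => -y) (𝓝[≥] x) (𝓝[≤] (-x)) :=
    continuous_neg.continuousWithinAt.tendsto_nhdsWithin fun y (hy : x ≤ y) => Set.mem_Iic.2 (neg_le_neg hy)
  have tl : Tendsto (fun y : ℝ => -y) (𝓝[≤] x) (𝓝[≥] (-x)) :=
    continuous_neg.continuousWithinAt.tendsto_nhdsWithin fun y (hy : y ≤ x) => Set.mem_Ici.2 (neg_le_neg hy)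
  refine ⟨_, reflect_mem hB, _, reflect_mem hA, ?_, ?_, ?_⟩
  · filter_upwards [tl.eventually h2] with y hy
    simpa using hy
  · filter_upwards [tr.eventually h1] with y hy
    simpa using hy
  · rcases h3 with h | rfl
    · exact .inl (by simpa using h.neg)
    · exact .inr rfl

/-- A map taking `γ` to `γ'` that is good to the left of `γ` and intertwines `g` and `g'` there. -/
def LeftConj (γ γ' : ℝ) (g g' : ℝ ≃o ℝ) : Prop :=
  ∃ Φ : ℝ ≃o ℝ, Φ γ = γ' ∧ (∀ x < γ, Good id Φ x) ∧ ∀ x < γ, Φ (g x) = g' (Φ x)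

/-- The right side of `γ` is the left side of `-γ` after reflection. The two halves glue to an
intertwiner because `g` fixes `γ` and so preserves each side. -/
lemma exists_semiconj_of_leftConj {γ γ' : ℝ} {g g' : ℝ ≃o ℝ} (hg : g γ = γ) (hg' : g' γ' = γ')
    (hl : LeftConj γ γ' g g') (hr : LeftConj (-γ) (-γ') (reflect g) (reflect g')) :
    ∃ Φ : ℝ ≃o ℝ, Φ γ = γ' ∧ (∀ x, x ≠ γ → Good id Φ x) ∧ SemiconjBy Φ g g' := by
  obtain ⟨f, hf, hfg, hfs⟩ := hl
  obtain ⟨h, hh, hhg, hhs⟩ := hr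
  obtain ⟨Φ, h1, h2⟩ := exists_orderIso_glue (f := f) (g := reflect h) (a := γ) (by simp [hf, hh])
  have hΦ : Φ γ = γ' := by rw [h1 γ le_rfl, hf]
  refine ⟨Φ, hΦ, ?_, ?_⟩
  · intro x hx
    rcases lt_or_gt_of_ne hx with hx | hx
    · exact (hfg x hx).congr ((eventually_lt_nhds hx).mono fun y hy => h1 y hy.le)
    · exact (hhg (-x) (neg_lt_neg hx)).reflect.congr
        ((eventually_gt_nhds hx).mono fun y hy => h2 y hy.le)
  · ext x
    rw [RelIso.mul_apply, RelIso.mul_apply]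
    rcases lt_trichotomy x γ with hx | rfl | hx
    · have : g x < γ := by rw [← hg]; exact g.strictMono hx
      rw [h1 _ this.le, h1 _ hx.le, hfs x hx]
    · rw [hg, hΦ, hg']
    · have : γ < g x := by
        conv_lhs => rw [← hg]
        exact g.strictMono hx
      rw [h2 _ this.le, h2 _ hx.le]
      have := hhs (-x) (neg_lt_neg hx)
      simp only [reflect_apply, neg_neg] at this
      simp [this]

lemma exists_isExhaustion_isDyadic (γ : ℝ) :
    ∃ a : ℤ → ℝ, IsExhaustion a γ ∧ ∀ n, IsDyadic (a n) := by
  have h4 : ∀ n : ℤ, (0 : ℝ) < 4 ^ n := fun n => by positivity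
  have hinv : ∀ n : ℤ, (4 : ℝ) ^ (-n) * 4 ^ n = 1 := fun n => by
    rw [← zpow_add₀ (by norm_num)]; simp
  -- Truncation of `γ` to the grid of mesh `4 ^ (-n)`; subtracting one further mesh keeps the
  -- distance to `γ` between one and two meshes and makes the sequence strictly increasing.
  refine ⟨fun n => 4 ^ (-n) * (⌊4 ^ n * γ⌋ - 1), IsExhaustion.of_bounds (r := 4) (C := 2) (c := 1)
    (strictMono_int_of_lt_succ fun n => ?_) (by norm_num) (by norm_num) one_pos
    (fun n => ?_) (fun n => ?_), fun n => ?_⟩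
  · have h1 : (4 : ℝ) ^ (n + 1) = 4 * 4 ^ n := by rw [zpow_add₀ (by norm_num)]; ring
    have h2 : (4 : ℝ) ^ (-n) = 4 ^ (-(n + 1)) * 4 := by
      rw [neg_add, zpow_add₀ (by norm_num), mul_assoc]; norm_num
    have h3 : 4 * ⌊(4 : ℝ) ^ n * γ⌋ ≤ ⌊(4 : ℝ) ^ (n + 1) * γ⌋ := by
      rw [Int.le_floor, h1]
      push_cast
      have := Int.floor_le ((4 : ℝ) ^ n * γ)
      linarith
    have h5 : 4 * (⌊(4 : ℝ) ^ n * γ⌋ : ℝ) ≤ ⌊(4 : ℝ) ^ (n + 1) * γ⌋ := by exact_mod_cast h3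
    rw [h2, mul_assoc]
    exact mul_lt_mul_of_pos_left (by linarith) (h4 _)
  · have := (Int.lt_floor_add_one ((4 : ℝ) ^ n * γ)).le
    have h6 := mul_le_mul_of_nonneg_left this (h4 (-n)).le
    rw [← mul_assoc, hinv] at h6
    linarith
  · have := Int.floor_le ((4 : ℝ) ^ n * γ)
    have h6 := mul_le_mul_of_nonneg_left this (h4 (-n)).le
    rw [← mul_assoc, hinv] at h6
    linarith
  · have : (4 : ℝ) ^ (-n) = 2 ^ (-(2 * n)) := by
      rw [← mul_neg, zpow_mul]; norm_num
    simp only [this]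
    exact IsDyadic.zpow_mul ⟨⌊(4 : ℝ) ^ n * γ⌋ - 1, 0, by simp⟩ _

lemma leftConj_one (γ γ' : ℝ) : LeftConj γ γ' 1 1 := by
  obtain ⟨a, ha, had⟩ := exists_isExhaustion_isDyadic γ
  obtain ⟨a', ha', had'⟩ := exists_isExhaustion_isDyadic γ'
  choose θ hθ h1 h2 using fun n => exists_goodGroup_pair (had n) (had (n + 1)) (had' n)
    (had' (n + 1)) (ha.strictMono (lt_add_one n)) (ha'.strictMono (lt_add_one n))
  obtain ⟨Φ, hΦ, hg, -⟩ := exists_glue_exhaustion ha ha' had θ hθ h1 h2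
  exact ⟨Φ, hΦ, hg, fun _ _ => rfl⟩

/-! ### Germs of dyadic affine maps at a fixed point -/

/-- The homotheties `x ↦ γ + 2 ^ k * (x - γ)` with centre `γ`. -/
noncomputable def homothety (γ : ℝ) : Multiplicative ℤ →* (ℝ ≃o ℝ) where
  toFun k := affineIso k.toAdd (γ - 2 ^ k.toAdd * γ)
  map_one' := by ext; simp
  map_mul' k l := by
    ext x
    rw [RelIso.mul_apply]
    simp only [affineIso_apply, toAdd_mul, zpow_add₀ (two_ne_zero' ℝ)]
    ring

lemma homothety_apply (γ : ℝ) (k : Multiplicative ℤ) (x : ℝ) :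
    homothety γ k x = γ + 2 ^ k.toAdd * (x - γ) := by
  simp only [homothety, MonoidHom.coe_mk, OneHom.coe_mk, affineIso_apply]
  ring

lemma homothety_self (γ : ℝ) (k : Multiplicative ℤ) : homothety γ k γ = γ := by
  simp [homothety_apply]

lemma reflect_homothety (γ : ℝ) (k : Multiplicative ℤ) :
    reflect (homothety γ k) = homothety (-γ) k := by
  ext x
  simp only [reflect_apply, homothety_apply]
  ring

lemma exists_eq_homothety {A : ℝ ≃o ℝ} (hA : A ∈ dyadicAffine) {γ : ℝ} (h : A γ = γ) :
    ∃ k, A = homothety γ k := by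
  obtain ⟨k, d, -, rfl⟩ := hA
  refine ⟨.ofAdd k, ?_⟩
  ext x
  rw [affineIso_apply] at h
  simp only [affineIso_apply, homothety_apply, toAdd_ofAdd]
  linarith

lemma homothety_zpow_apply (γ : ℝ) (m : ℕ) (n : ℤ) (x : ℝ) :
    (homothety γ (.ofAdd (-m : ℤ)) ^ n) x = γ + (2 ^ m) ^ (-n) * (x - γ) := by
  rw [← map_zpow, homothety_apply, ← ofAdd_zsmul, toAdd_ofAdd, ← zpow_natCast (2 : ℝ) m, ← zpow_mul]
  simp [mul_comm]

lemma isExhaustion_homothety {γ a : ℝ} {m : ℕ} (hm : 0 < m) (ha : a < γ) :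
    IsExhaustion (fun n => (homothety γ (.ofAdd (-m : ℤ)) ^ n) a) γ := by
  have hr : (1 : ℝ) < 2 ^ m := one_lt_pow₀ one_lt_two hm.ne'
  have hs := sub_pos.2 ha
  refine .of_bounds (r := 2 ^ m) (C := γ - a) (c := γ - a) (strictMono_int_of_lt_succ fun n => ?_)
    hr hs hs (fun n => ?_) (fun n => ?_)
  · rw [homothety_zpow_apply, homothety_zpow_apply]
    have : ((2 : ℝ) ^ m) ^ (-(n + 1)) < (2 ^ m) ^ (-n) := zpow_lt_zpow_right₀ hr (by omega)
    nlinarith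
  · rw [homothety_zpow_apply]; linarith
  · rw [homothety_zpow_apply]; linarith

lemma exists_isDyadic_lt (γ : ℝ) : ∃ a < γ, IsDyadic a := by
  obtain ⟨a, ha, hd⟩ := exists_isExhaustion_isDyadic γ
  exact ⟨a 0, ha.lt 0, hd 0⟩

/-- The interval from `a` to `g a` is a fundamental domain for `g` to the left of `γ`. A good `θ`
takes it to the interval from `b` to `g' b`, and `g' ^ n * θ * (g ^ n)⁻¹` extends it equivariantly.
The ratios of `g` and `g'` may differ. -/
lemma leftConj_homothety {γ γ' : ℝ} {m m' : ℕ} (hm : 0 < m) (hm' : 0 < m')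
    (hg : homothety γ (.ofAdd (-m : ℤ)) ∈ dyadicAffine)
    (hg' : homothety γ' (.ofAdd (-m' : ℤ)) ∈ dyadicAffine) :
    LeftConj γ γ' (homothety γ (.ofAdd (-m : ℤ))) (homothety γ' (.ofAdd (-m' : ℤ))) := by
  obtain ⟨a, ha, had⟩ := exists_isDyadic_lt γ
  obtain ⟨b, hb, hbd⟩ := exists_isDyadic_lt γ'
  have hea := isExhaustion_homothety hm ha
  have heb := isExhaustion_homothety hm' hb
  set g := homothety γ (.ofAdd (-m : ℤ))
  set g' := homothety γ' (.ofAdd (-m' : ℤ))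
  have hda : ∀ n : ℤ, IsDyadic ((g ^ n) a) := fun n =>
    (isDyadic_apply_iff (zpow_mem hg n) a).2 had
  have hdb : ∀ n : ℤ, IsDyadic ((g' ^ n) b) := fun n =>
    (isDyadic_apply_iff (zpow_mem hg' n) b).2 hbd
  obtain ⟨θ, hθ, h0, h1⟩ := exists_goodGroup_pair (hda 0) (hda 1) (hdb 0) (hdb 1)
    (hea.strictMono one_pos) (heb.strictMono one_pos)
  simp only [zpow_zero, zpow_one, RelIso.one_apply] at h0 h1
  obtain ⟨Φ, hΦ, hgood, hcell⟩ := exists_glue_exhaustion hea heb hda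
    (fun n => g' ^ n * θ * (g ^ n)⁻¹) (fun n => mul_mem (mul_mem
      (zpow_mem (dyadicAffine_le_goodGroup hg') n) hθ)
      (inv_mem (zpow_mem (dyadicAffine_le_goodGroup hg) n)))
    (fun n => by
      rw [← RelIso.mul_apply, inv_mul_cancel_right, RelIso.mul_apply, h0])
    (fun n => by
      rw [← RelIso.mul_apply, zpow_add_one, ← mul_assoc, inv_mul_cancel_right, RelIso.mul_apply,
        RelIso.mul_apply, h1, zpow_add_one, RelIso.mul_apply])
  refine ⟨Φ, hΦ, hgood, fun x hx => ?_⟩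
  obtain ⟨n, hn, hn'⟩ := hea.exists_cell hx
  -- `g` shifts cell `n` to cell `n + 1`.
  rw [hcell n x hn hn'.le, hcell (n + 1) (g x)]
  · simp only [← RelIso.mul_apply]
    congr 1
    rw [add_comm n 1, zpow_one_add, zpow_one_add, mul_inv_rev]
    group
  · rw [add_comm, zpow_one_add, RelIso.mul_apply]
    exact g.monotone hn
  · rw [add_comm, zpow_one_add, RelIso.mul_apply]
    exact g.monotone hn'.le

/-- If `k ≠ 0`, the only fixed point of `2 ^ k * x + d` is `d / (1 - 2 ^ k)`, which is rational for
dyadic `d`; if `k = 0`, a fixed point forces `d = 0`. -/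
lemma eq_one_of_irrational {γ : ℝ} (h : Irrational γ) {A : ℝ ≃o ℝ}
    (hA : A ∈ dyadicAffine) (hγ : A γ = γ) : A = 1 := by
  obtain ⟨k, d, ⟨p, q, rfl⟩, rfl⟩ := hA
  rw [affineIso_apply] at hγ
  have hk : k = 0 := by
    by_contra hk
    have h1 : (1 : ℝ) - 2 ^ k ≠ 0 := by
      rw [sub_ne_zero, ne_comm, Ne, zpow_eq_one_iff_right₀ (by norm_num) (by norm_num)]
      exact hk
    refine h ⟨(p / 2 ^ q) / (1 - 2 ^ k), ?_⟩
    push_cast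
    rw [div_eq_iff h1]
    linarith
  subst hk
  ext x
  simp only [affineIso_apply, zpow_zero, one_mul, RelIso.coe_one, id] at hγ ⊢
  linarith

/-- Write the denominator of `γ` as `2 ^ s * q` with `q` odd. By Euler, `q` divides `2 ^ φ(q) - 1`,
so the homothety of ratio `2 ^ φ(q)` has dyadic translation part `γ * (1 - 2 ^ φ(q))`. -/
lemma exists_homothety_mem {γ : ℝ} (h : ¬ Irrational γ) :
    ∃ k : Multiplicative ℤ, k ≠ 1 ∧ homothety γ k ∈ dyadicAffine := by
  obtain ⟨r, rfl⟩ := not_not.1 h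
  obtain ⟨s, q, hq, hr⟩ := Nat.exists_eq_two_pow_mul_odd r.den_nz
  have hmod := Nat.ModEq.pow_totient (Nat.coprime_two_left.2 hq)
  obtain ⟨t, ht⟩ := (Nat.modEq_iff_dvd' Nat.one_le_two_pow).1 hmod.symm
  have hq0 : (q : ℝ) ≠ 0 := by exact_mod_cast hq.pos.ne'
  have ht' : (2 : ℝ) ^ q.totient - 1 = q * t := by
    have := congrArg (Nat.cast (R := ℝ)) ht
    rwa [Nat.cast_sub Nat.one_le_two_pow, Nat.cast_mul, Nat.cast_pow, Nat.cast_one,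
      Nat.cast_ofNat] at this
  refine ⟨.ofAdd q.totient, ?_, affineIso_mem _ ⟨-(t * r.num), s, ?_⟩⟩
  · have := Nat.totient_pos.2 hq.pos
    rw [Ne, ofAdd_eq_one]
    exact_mod_cast this.ne'
  · rw [toAdd_ofAdd, zpow_natCast]
    have hden : ((r : ℚ) : ℝ) = r.num / (2 ^ s * q) := by
      rw [Rat.cast_def, hr]
      push_cast
      rfl
    rw [hden]
    push_cast
    field_simp
    linear_combination -(r.num : ℝ) * ht'

/-- The admissible exponents form a nontrivial subgroup of `ℤ`, hence a cyclic one. The generator is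
taken with negative exponent so that it contracts towards `γ`. -/
lemma exists_generator_of_rational {γ : ℝ} (h : ¬ Irrational γ) :
    ∃ m : ℕ, 0 < m ∧ homothety γ (.ofAdd (-m : ℤ)) ∈ dyadicAffine ∧ ∀ A ∈ dyadicAffine, A γ = γ →
      A ∈ Subgroup.zpowers (homothety γ (.ofAdd (-m : ℤ))) := by
  obtain ⟨k, hk1, hk⟩ := exists_homothety_mem h
  obtain ⟨⟨l, hl⟩, hgen⟩ := IsCyclic.exists_generator (α := dyadicAffine.comap (homothety γ))
  have hgen' : ∀ j, homothety γ j ∈ dyadicAffine → j ∈ Subgroup.zpowers l := by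
    intro j hj
    obtain ⟨n, hn⟩ := hgen ⟨j, hj⟩
    exact ⟨n, congrArg Subtype.val hn⟩
  have hl1 : l ≠ 1 := by
    rintro rfl
    exact hk1 (by simpa using hgen' k hk)
  have hex : ∃ m : ℕ, 0 < m ∧ homothety γ (.ofAdd (-m : ℤ)) ∈ dyadicAffine ∧
      Subgroup.zpowers l = Subgroup.zpowers (.ofAdd (-m : ℤ)) := by
    have hl0 : l.toAdd ≠ 0 := by simpa using hl1
    obtain ⟨m, hm | hm⟩ := l.toAdd.eq_nat_or_neg
    · have e : l = (Multiplicative.ofAdd (-m : ℤ))⁻¹ := by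
        rw [← ofAdd_neg, neg_neg, ← hm, ofAdd_toAdd]
      refine ⟨m, by omega, ?_, by rw [e, Subgroup.zpowers_inv]⟩
      have : Multiplicative.ofAdd (-m : ℤ) = l⁻¹ := by rw [e, inv_inv]
      rw [this, map_inv]
      exact inv_mem hl
    · have e : l = Multiplicative.ofAdd (-m : ℤ) := by rw [← hm, ofAdd_toAdd]
      exact ⟨m, by omega, e ▸ hl, by rw [e]⟩
  obtain ⟨m, hm, hmem, hz⟩ := hex
  refine ⟨m, hm, hmem, fun A hA hAγ => ?_⟩
  obtain ⟨j, rfl⟩ := exists_eq_homothety hA hAγ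
  obtain ⟨n, rfl⟩ := hz ▸ hgen' j hA
  exact ⟨n, (map_zpow _ _ _).symm⟩

/-! ### Maps matching germs at points with the same letter -/

/-- Near the point `x`, the map `f` conjugates the dyadic affine maps fixing `x` to dyadic affine
maps. -/
def Compat (f : ℝ ≃o ℝ) (x : ℝ) : Prop :=
  ∀ A ∈ dyadicAffine, A x = x → ∃ A' ∈ dyadicAffine, ∀ᶠ y in 𝓝 x, f (A y) = A' (f y)

/-- `f` is good at `x`, or it exchanges the germs of dyadic affine maps at the non-dyadic points
`x` and `f x`. -/
def Admissible (f : ℝ ≃o ℝ) (x : ℝ) : Prop :=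
  Good id f x ∨ ¬ IsDyadic x ∧ ¬ IsDyadic (f x) ∧ Compat f x ∧ Compat f⁻¹ (f x)

lemma Compat.congr {f g : ℝ ≃o ℝ} {x : ℝ} (hg : Compat g x) (h : ∀ᶠ y in 𝓝 x, f y = g y) :
    Compat f x := by
  intro A hA hAx
  obtain ⟨A', hA', h1⟩ := hg A hA hAx
  have ht : Tendsto A (𝓝 x) (𝓝 x) := by
    simpa [hAx] using A.continuous.tendsto x
  refine ⟨A', hA', ?_⟩
  filter_upwards [h1, h, ht.eventually h] with y h1 h2 h3
  rw [h3, h1, h2]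

lemma Admissible.congr {f g : ℝ ≃o ℝ} {x : ℝ} (hg : Admissible g x)
    (h : ∀ᶠ y in 𝓝 x, f y = g y) : Admissible f x := by
  rcases hg with hg | ⟨h1, h2, h3, h4⟩
  · exact .inl (hg.congr h)
  · rw [← h.self_of_nhds] at h2 h4
    refine .inr ⟨h1, h2, h3.congr h, h4.congr ?_⟩
    have ht : Tendsto (f⁻¹ : ℝ ≃o ℝ) (𝓝 (f x)) (𝓝 x) := by
      have := (f⁻¹ : ℝ ≃o ℝ).continuous.tendsto (f x)
      rwa [show f⁻¹ (f x) = x from f.symm_apply_apply x] at this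
    filter_upwards [ht.eventually h] with y hy
    rw [show f (f⁻¹ y) = y from f.apply_symm_apply y] at hy
    conv_rhs => rw [hy]
    exact (g.symm_apply_apply _).symm

lemma compat_of_semiconj {f g g' : ℝ ≃o ℝ} {x : ℝ} (h : SemiconjBy f g g')
    (hg : ∀ A ∈ dyadicAffine, A x = x → A ∈ Subgroup.zpowers g) (hg' : g' ∈ dyadicAffine) :
    Compat f x := by
  intro A hA hx
  obtain ⟨n, rfl⟩ := hg A hA hx
  refine ⟨g' ^ n, zpow_mem hg' n, .of_forall fun y => ?_⟩
  have := (h.zpow_right n).eq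
  exact DFunLike.congr_fun this y

lemma exists_admissible_of_generators {γ γ' : ℝ} {g g' : ℝ ≃o ℝ} (hγ : ¬ IsDyadic γ)
    (hγ' : ¬ IsDyadic γ') (hg : g ∈ dyadicAffine) (hg' : g' ∈ dyadicAffine) (hgγ : g γ = γ)
    (hgγ' : g' γ' = γ') (hl : LeftConj γ γ' g g')
    (hr : LeftConj (-γ) (-γ') (reflect g) (reflect g'))
    (hz : ∀ A ∈ dyadicAffine, A γ = γ → A ∈ Subgroup.zpowers g)
    (hz' : ∀ A ∈ dyadicAffine, A γ' = γ' → A ∈ Subgroup.zpowers g') :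
    ∃ Φ : ℝ ≃o ℝ, Φ γ = γ' ∧ (∀ x, x ≠ γ → Good id Φ x) ∧ Admissible Φ γ := by
  obtain ⟨Φ, h1, h2, h3⟩ := exists_semiconj_of_leftConj hgγ hgγ' hl hr
  refine ⟨Φ, h1, h2, .inr ⟨hγ, by rwa [h1], compat_of_semiconj h3 hz hg', ?_⟩⟩
  rw [h1]
  exact compat_of_semiconj h3.inv_symm_left hz' hg

/-- Two numbers with the same letter are related by an automorphism of the line that is good
elsewhere. -/
lemma exists_admissible_of_letter_eq {γ γ' : ℝ} (h : letter γ = letter γ') :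
    ∃ Φ : ℝ ≃o ℝ, Φ γ = γ' ∧ (∀ x, x ≠ γ → Good id Φ x) ∧ Admissible Φ γ := by
  unfold letter at h
  split_ifs at h
  all_goals try omega
  · have hd : IsDyadic (γ' - γ) := IsDyadic.sub ‹_› ‹_›
    have hg := dyadicAffine_le_goodGroup (affineIso_mem 0 hd)
    exact ⟨_, by simp, fun x _ => hg x, .inl (hg γ)⟩
  -- Irrational points: both germ groups are trivial, generated by 1.
  · have h1 : reflect 1 = 1 := by ext; simp
    refine exists_admissible_of_generators (g := 1) (g' := 1) ‹_› ‹_› (one_mem _) (one_mem _) rfl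
      rfl (leftConj_one _ _) ?_ ?_ ?_
    · rw [h1]
      exact leftConj_one _ _
    · intro A hA hAγ
      rw [eq_one_of_irrational ‹Irrational γ› hA hAγ]
      exact one_mem _
    · intro A hA hAγ
      rw [eq_one_of_irrational ‹Irrational γ'› hA hAγ]
      exact one_mem _
  · obtain ⟨m, hm, hg, hz⟩ := exists_generator_of_rational ‹¬ Irrational γ›
    obtain ⟨m', hm', hg', hz'⟩ := exists_generator_of_rational ‹¬ Irrational γ'›
    refine exists_admissible_of_generators ‹_› ‹_› hg hg' (homothety_self _ _) (homothety_self _ _)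
      (leftConj_homothety hm hm' hg hg') ?_ hz hz'
    -- Reflection turns the generators into homotheties centred at `-γ` and `-γ'`, so the left-hand
    -- construction applies again.
    have hr := reflect_mem hg
    have hr' := reflect_mem hg'
    rw [reflect_homothety] at hr hr' ⊢
    rw [reflect_homothety]
    exact leftConj_homothety hm hm' hr hr'

/-! ### Joining local maps over finitely many points -/

lemma exists_isDyadic_between {x y : ℝ} (h : x < y) : ∃ z, IsDyadic z ∧ x < z ∧ z < y := by
  obtain ⟨a, ha, hd⟩ := exists_isExhaustion_isDyadic y
  obtain ⟨n, hn⟩ := ha.exists_gt x h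
  exact ⟨a n, hd n, hn, ha.lt n⟩

/-- Keep `f` up to a dyadic `p` near `u` and `g` from a dyadic `q` near `w`, and bridge by a good
map taking `p`, `q` to the dyadic values `f p`, `g q`. Placing `f p` and `g q` on either side of an
intermediate value `m` puts them in the right order. -/
lemma exists_connect {f g : ℝ ≃o ℝ} {u w : ℝ} (huw : u < w) (hfg : f u < g w)
    (hf : ∀ x, u < x → x < w → Good id f x) (hg : ∀ x, u < x → x < w → Good id g x) :
    ∃ Φ : ℝ ≃o ℝ, (∃ p > u, ∀ x ≤ p, Φ x = f x) ∧ (∃ q < w, ∀ x, q ≤ x → Φ x = g x) ∧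
      ∀ x, u < x → x < w → Good id Φ x := by
  obtain ⟨m, hm1, hm2⟩ := exists_between hfg
  obtain ⟨p, hpd, hup, hp⟩ := exists_isDyadic_between
    (lt_min huw (f.lt_symm_apply.2 hm1))
  obtain ⟨hpw, hpm⟩ := lt_min_iff.1 hp
  obtain ⟨q, hqd, hq, hqw⟩ := exists_isDyadic_between
    (max_lt hpw (g.symm_apply_lt.2 hm2))
  obtain ⟨hpq, hqm⟩ := max_lt_iff.1 hq
  have hfgpq : f p < g q := (f.lt_symm_apply.1 hpm).trans (g.symm_apply_lt.1 hqm)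
  obtain ⟨θ, hθ, hθp, hθq⟩ := exists_goodGroup_pair hpd hqd
    ((hf p hup hpw).isDyadic_iff.2 hpd) ((hg q (hup.trans hpq) hqw).isDyadic_iff.2 hqd) hpq hfgpq
  obtain ⟨Ψ, hΨ1, hΨ2⟩ := exists_orderIso_glue hθp.symm
  obtain ⟨Φ, hΦ1, hΦ2⟩ := exists_orderIso_glue (f := Ψ) (g := g) (a := q)
    (by rw [hΨ2 q hpq.le, hθq, id])
  have e1 : ∀ x ≤ p, Φ x = f x := fun x hx => by rw [hΦ1 x (hx.trans hpq.le), hΨ1 x hx]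
  have e2 : ∀ x, p ≤ x → x ≤ q → Φ x = θ x := fun x hx hx' => by rw [hΦ1 x hx', hΨ2 x hx]
  refine ⟨Φ, ⟨p, hup, e1⟩, ⟨q, hqw, hΦ2⟩, fun x hux hxw => ?_⟩
  rcases lt_trichotomy x p with hx | rfl | hx
  · exact (hf x hux hxw).congr ((eventually_lt_nhds hx).mono fun y hy => e1 y hy.le)
  · refine (hf x hux hxw).glue (hθ x) hpd (eventually_mem_nhdsWithin.mono fun y hy => e1 y hy) ?_
    filter_upwards [eventually_mem_nhdsWithin, nhdsWithin_le_nhds (eventually_le_nhds hpq)]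
      with y hy hy' using e2 y hy hy'
  rcases lt_trichotomy x q with hx' | rfl | hx'
  · refine (hθ x).congr ?_
    filter_upwards [eventually_ge_nhds hx, eventually_le_nhds hx'] with y hy hy' using e2 y hy hy'
  · refine (hθ x).glue (hg x hux hxw) hqd ?_
      (eventually_mem_nhdsWithin.mono fun y hy => hΦ2 y hy)
    filter_upwards [eventually_mem_nhdsWithin, nhdsWithin_le_nhds (eventually_ge_nhds hpq)]
      with y hy hy' using e2 y hy' hy
  · exact (hg x hux hxw).congr ((eventually_gt_nhds hx').mono fun y hy => hΦ2 y hy.le)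

/-- Induction on the points: the map at the first point is joined, inside the gap before the second,
to the map for the remaining ones. -/
lemma exists_admissible_of_map_letter_eq (us vs : List ℝ) (hus : us.Pairwise (· < ·))
    (hvs : vs.Pairwise (· < ·)) (h : us.map letter = vs.map letter) :
    ∃ Φ : ℝ ≃o ℝ, us.map Φ = vs ∧ (∀ x, Admissible Φ x) ∧ ∀ x ∉ us, Good id Φ x := by
  induction us generalizing vs with
  | nil =>
    obtain rfl : vs = [] := by simpa using h.symm
    exact ⟨1, rfl, fun x => .inl (good_of_mem (one_mem _) x), fun x _ => good_of_mem (one_mem _) x⟩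
  | cons u us ih =>
    obtain - | ⟨v, vs⟩ := vs
    · simp at h
    simp only [List.map_cons, List.cons.injEq] at h
    obtain ⟨f, hfu, hfg, hfa⟩ := exists_admissible_of_letter_eq h.1
    obtain ⟨g, hgm, hga, hgg⟩ := ih vs hus.of_cons hvs.of_cons h.2
    obtain - | ⟨w, us⟩ := us
    · obtain rfl : vs = [] := by simpa using h.2.symm
      refine ⟨f, by simp [hfu], fun x => ?_, fun x hx => hfg x (by simpa using hx)⟩
      by_cases hx : x = u
      · exact hx ▸ hfa
      · exact .inl (hfg x hx)
    have huw : u < w := List.rel_of_pairwise_cons hus (by simp)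
    have hw : ∀ x ∈ w :: us, w ≤ x := by
      intro x hx
      rcases List.mem_cons.1 hx with rfl | hx
      · exact le_rfl
      · exact (List.rel_of_pairwise_cons hus.of_cons hx).le
    have hvw : f u < g w := by
      rw [hfu]
      exact List.rel_of_pairwise_cons hvs (by rw [← hgm]; simp)
    obtain ⟨Φ, ⟨p, hp, hΦp⟩, ⟨q, hq, hΦq⟩, hΦg⟩ := exists_connect huw hvw
      (fun x hx _ => hfg x hx.ne') (fun x _ hx => hgg x fun hm => (hw x hm).not_gt hx)
    have nl : ∀ x ≤ u, ∀ᶠ y in 𝓝 x, Φ y = f y := fun x hx =>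
      (eventually_lt_nhds (hx.trans_lt hp)).mono fun y hy => hΦp y hy.le
    have nr : ∀ x, w ≤ x → ∀ᶠ y in 𝓝 x, Φ y = g y := fun x hx =>
      (eventually_gt_nhds (hq.trans_le hx)).mono fun y hy => hΦq y hy.le
    have hgood : ∀ x ∉ u :: w :: us, Good id Φ x := by
      intro x hx
      rw [List.mem_cons, not_or] at hx
      rcases le_or_gt x u with hxu | hxu
      · exact (hfg x hx.1).congr (nl x hxu)
      rcases lt_or_ge x w with hxw | hxw
      · exact hΦg x hxu hxw
      · exact (hgg x hx.2).congr (nr x hxw)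
    refine ⟨Φ, ?_, fun x => ?_, hgood⟩
    · rw [List.map_cons, hΦp u hp.le, hfu, ← hgm]
      congr 1
      exact List.map_congr_left fun x hx => hΦq x (hq.le.trans (hw x hx))
    · by_cases hx : x ∈ u :: w :: us
      · rcases List.mem_cons.1 hx with rfl | hx
        · exact hfa.congr (nl x le_rfl)
        · exact (hga x).congr (nr x (hw x hx))
      · exact .inl (hgood x hx)

/-! ### Thompson maps are exactly the good maps of [0,1] -/

lemma exists_isDyadic_mem_Ioo {a b : I} (hab : a < b) :
    ∃ z : I, IsDyadic z ∧ z ∈ Set.Ioo a b := by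
  obtain ⟨z, hz, h1, h2⟩ := exists_isDyadic_between (show (a : ℝ) < b from hab)
  exact ⟨⟨z, a.2.1.trans h1.le, h2.le.trans b.2.2⟩, hz, h1, h2⟩

/-- Dyadicity of the constant term is not part of the definition; it follows by evaluating at a
dyadic point, whose image is dyadic. -/
lemma IsThompsonMap.exists_mem_dyadicAffine {f : I ≃o I} (hf : IsThompsonMap f) {a b : I}
    (hab : a < b) {k : ℤ} {d : ℝ} (h : ∀ x ∈ Set.Icc a b, (f x : ℝ) = (2 : ℝ) ^ k * x + d) :
    ∃ A ∈ dyadicAffine, ∀ x ∈ Set.Icc a b, (f x : ℝ) = A x := by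
  obtain ⟨z, hz, hza⟩ := exists_isDyadic_mem_Ioo hab
  refine ⟨affineIso k d, affineIso_mem k ?_, fun x hx => h x hx⟩
  have := ((hf.isDyadic_iff z).2 hz).sub (hz.zpow_mul k)
  rwa [h z (Set.Ioo_subset_Icc_self hza), add_sub_cancel_left] at this

lemma IsThompsonMap.good {f : I ≃o I} (hf : IsThompsonMap f) (x : I) :
    Good Subtype.val f x := by
  have hf' := hf
  obtain ⟨B, hB, h⟩ := hf
  have piece : ∀ a b : I, a < b → (∀ y ∈ Set.Ioo a b, y ∉ B) →
      ∃ A ∈ dyadicAffine, ∀ x ∈ Set.Icc a b, (f x : ℝ) = A x := by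
    intro a b hab hfree
    obtain ⟨k, d, hkd⟩ := h a b hab fun c hc hcI => hfree c hcI hc
    exact hf'.exists_mem_dyadicAffine hab hkd
  have hfree : ∀ᶠ y in 𝓝 x, y ≠ x → y ∉ B := by
    have : ∀ᶠ y in 𝓝 x, ∀ c ∈ B, y ≠ x → c ≠ y := by
      rw [Filter.eventually_all_finset]
      intro c _
      by_cases hc : c = x
      · simp [hc, eq_comm]
      · filter_upwards [eventually_ne_nhds (Ne.symm hc)] with y hy _ using hy.symm
    filter_upwards [this] with y hy hyx hyB using hy y hyB hyx rfl
  by_cases hx : IsDyadic x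
  · have hl : ∃ A ∈ dyadicAffine, ∀ᶠ y in 𝓝[≤] x, (f y : ℝ) = A y := by
      -- At the endpoint 0 the left neighbourhood is a single fixed point, so the identity serves.
      rcases eq_or_ne x ⊥ with rfl | hx0
      · refine ⟨1, one_mem _, ?_⟩
        simp
      obtain ⟨a, ha, hax⟩ := exists_Ioc_subset_of_mem_nhds hfree ⟨⊥, bot_lt_iff_ne_bot.2 hx0⟩
      obtain ⟨A, hA, hAe⟩ := piece a x ha fun y hy => hax ⟨hy.1, hy.2.le⟩ hy.2.ne
      refine ⟨A, hA, ?_⟩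
      filter_upwards [eventually_mem_nhdsWithin, nhdsWithin_le_nhds (eventually_ge_nhds ha)]
        with y hy hy' using hAe y ⟨hy', hy⟩
    have hr : ∃ A ∈ dyadicAffine, ∀ᶠ y in 𝓝[≥] x, (f y : ℝ) = A y := by
      rcases eq_or_ne x ⊤ with rfl | hx0
      · refine ⟨1, one_mem _, ?_⟩
        simp
      obtain ⟨b, hb, hbx⟩ := exists_Ico_subset_of_mem_nhds hfree ⟨⊤, lt_top_iff_ne_top.2 hx0⟩
      obtain ⟨A, hA, hAe⟩ := piece x b hb fun y hy => hbx ⟨hy.1.le, hy.2⟩ hy.1.ne'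
      refine ⟨A, hA, ?_⟩
      filter_upwards [eventually_mem_nhdsWithin, nhdsWithin_le_nhds (eventually_le_nhds hb)]
        with y hy hy' using hAe y ⟨hy, hy'⟩
    obtain ⟨A, hA, hAe⟩ := hl
    obtain ⟨A', hA', hAe'⟩ := hr
    exact ⟨A, hA, A', hA', hAe, hAe', .inl hx⟩
  · have hx0 : ⊥ < x := bot_lt_iff_ne_bot.2 <| by
      rintro rfl
      exact hx isDyadic_zero
    have hx1 : x < ⊤ := lt_top_iff_ne_top.2 <| by
      rintro rfl
      exact hx ⟨1, 0, by simp⟩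
    obtain ⟨a, b, ⟨ha, hb⟩, hab⟩ :=
      (mem_nhds_iff_exists_Ioo_subset' ⟨⊥, hx0⟩ ⟨⊤, hx1⟩).1 hfree
    obtain ⟨A, hA, hAe⟩ := piece a b (ha.trans hb) fun y hy hyB => by
      by_cases hyx : y = x
      · exact hx (hyx ▸ hB y hyB)
      · exact hab hy hyx hyB
    have : ∀ᶠ y in 𝓝 x, (f y : ℝ) = A y := by
      filter_upwards [eventually_ge_nhds ha, eventually_le_nhds hb] with y hy hy'
        using hAe y ⟨hy, hy'⟩
    exact ⟨A, hA, A, hA, nhdsWithin_le_nhds this, nhdsWithin_le_nhds this, .inr rfl⟩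

/-- By compactness finitely many one-sided descriptions cover [0,1], and breaks occur only at dyadic
centres of the cover. On an interval avoiding these the affine germ is locally constant, hence
constant by connectedness; continuity adds the endpoints. -/
lemma IsThompsonMap.of_good {f : I ≃o I} (hf : ∀ x, Good Subtype.val f x) : IsThompsonMap f := by
  classical
  choose A hA B hB h1 h2 h3 using hf
  have hU : ∀ x, ∀ᶠ y in 𝓝 x, (y ≤ x → (f y : ℝ) = A x y) ∧ (x ≤ y → (f y : ℝ) = B x y) :=
    fun x => (eventually_nhdsWithin_iff.1 (h1 x)).and (eventually_nhdsWithin_iff.1 (h2 x))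
  obtain ⟨t, ht⟩ := CompactSpace.elim_nhds_subcover
    (fun x => interior {y | (y ≤ x → (f y : ℝ) = A x y) ∧ (x ≤ y → (f y : ℝ) = B x y)})
    fun x => interior_mem_nhds.2 (hU x)
  have hloc : ∀ y : I, (IsDyadic y → y ∉ t) → ∃ E ∈ dyadicAffine, ∀ᶠ z in 𝓝 y, (f z : ℝ) = E z := by
    intro y hy
    obtain ⟨x, hxt, hx⟩ := Set.mem_iUnion₂.1 (ht.ge (Set.mem_univ y))
    have hx' := mem_interior_iff_mem_nhds.1 hx
    rcases lt_trichotomy y x with hyx | rfl | hyx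
    · refine ⟨A x, hA x, ?_⟩
      filter_upwards [hx', eventually_lt_nhds hyx] with z hz hz' using hz.1 hz'.le
    · refine ⟨A y, hA y, ?_⟩
      have : A y = B y := (h3 y).resolve_left fun h => hy h hxt
      filter_upwards [hU y] with z hz
      rcases le_total z y with h | h
      · exact hz.1 h
      · rw [this]; exact hz.2 h
    · refine ⟨B x, hB x, ?_⟩
      filter_upwards [hx', eventually_gt_nhds hyx] with z hz hz' using hz.2 hz'.le
  refine ⟨t.filter fun x => IsDyadic x, fun b hb => (Finset.mem_filter.1 hb).2, fun a b hab hc => ?_⟩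
  have hloc' : ∀ y : I, y ∈ Set.Ioo a b → ∃ E ∈ dyadicAffine, ∀ᶠ z in 𝓝 y, (f z : ℝ) = E z :=
    fun y hy => hloc y fun hd ht => hc y (Finset.mem_filter.2 ⟨ht, hd⟩) hy
  choose! E hE hEz using hloc'
  have hconst : ∀ x ∈ Set.Ioo a b, ∀ y ∈ Set.Ioo a b, E x = E y := by
    intro x hx y hy
    refine isPreconnected_Ioo.induction₂ (fun x y => E x = E y) ?_ ?_ ?_ hx hy
    · intro x hx
      filter_upwards [(hEz x hx).eventually_nhds.filter_mono nhdsWithin_le_nhds,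
        eventually_mem_nhdsWithin] with y hy hyI
      obtain ⟨l, u, ⟨hl, hu⟩, hlu⟩ := (mem_nhds_iff_exists_Ioo_subset' ⟨a, hyI.1⟩ ⟨b, hyI.2⟩).1
        (hy.and (hEz y hyI))
      obtain ⟨z, hz1, hz2⟩ := exists_between hl
      have e1 := hlu ⟨hz1, hz2.trans hu⟩
      have e2 := hlu ⟨hl, hu⟩
      -- Both germs describe `f` at the two distinct points `z` and `y`, which determine an affine
      -- map.
      exact dyadicAffine_ext (hE x hx) (hE y hyI) (x := z) (y := y)
        (fun h => hz2.ne (Subtype.ext h)) (e1.1.symm.trans e1.2) (e2.1.symm.trans e2.2)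
    · intro x y z _ _ _ h1 h2
      exact h1.trans h2
    · intro x y _ _ h
      exact h.symm
  obtain ⟨m, hm⟩ := exists_between hab
  obtain ⟨k, d, -, hkd⟩ := hE m hm
  refine ⟨k, d, fun x hx => ?_⟩
  have hcl : Set.Icc a b ⊆ {y | (f y : ℝ) = E m y} := by
    rw [← closure_Ioo hab.ne]
    refine closure_minimal (fun y hy => ?_) (isClosed_eq (continuous_subtype_val.comp f.continuous)
      ((E m).continuous.comp continuous_subtype_val))
    rw [Set.mem_ofPred_eq, hconst m hm y hy]
    exact (hEz y hy).self_of_nhds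
  have := hcl hx
  rwa [Set.mem_ofPred_eq, hkd] at this

/-! ### Conjugation and the isomorphism of stabilizers -/

lemma Good.restrict {Φ : ℝ ≃o ℝ} {φ : I ≃o I} (hφ : ∀ x, (φ x : ℝ) = Φ x) {x : I}
    (h : Good id Φ x) : Good Subtype.val φ x := by
  obtain ⟨A, hA, B, hB, h1, h2, h3⟩ := h
  have tl : Tendsto (Subtype.val : I → ℝ) (𝓝[≤] x) (𝓝[≤] (x : ℝ)) :=
    continuous_subtype_val.continuousWithinAt.tendsto_nhdsWithin fun _ hy => hy
  have tr : Tendsto (Subtype.val : I → ℝ) (𝓝[≥] x) (𝓝[≥] (x : ℝ)) :=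
    continuous_subtype_val.continuousWithinAt.tendsto_nhdsWithin fun _ hy => hy
  refine ⟨A, hA, B, hB, ?_, ?_, h3⟩
  · filter_upwards [tl.eventually h1] with y hy
    rw [hφ]
    exact hy
  · filter_upwards [tr.eventually h2] with y hy
    rw [hφ]
    exact hy

/-- At a non-dyadic fixed point `f` agrees with one affine map `A` on both sides, and `Compat`
rewrites `Φ A` as `A' Φ`; `Φ` itself need not be good there. -/
lemma good_conj_of_compat {Φ : ℝ ≃o ℝ} {φ f : I ≃o I} (hφ : ∀ x, (φ x : ℝ) = Φ x) {x : I}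
    (hx : ¬ IsDyadic x) (hΦ : Compat Φ x) (hf : Good Subtype.val f x) (hfx : f x = x) :
    Good Subtype.val (φ * f * φ⁻¹) (φ x) := by
  obtain ⟨A, hA, B, hB, h1, h2, h3⟩ := hf
  obtain rfl := h3.resolve_left hx
  have h : ∀ᶠ y in 𝓝 x, (f y : ℝ) = A y := by
    rw [← nhdsLE_sup_nhdsGE]
    exact eventually_sup.2 ⟨h1, h2⟩
  have hAx : A x = x := by rw [← h.self_of_nhds, hfx]
  obtain ⟨A', hA', h'⟩ := hΦ A hA hAx
  have ht : Tendsto (φ⁻¹ : I ≃o I) (𝓝 (φ x)) (𝓝 x) := by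
    have := (φ⁻¹ : I ≃o I).continuous.tendsto (φ x)
    rwa [show φ⁻¹ (φ x) = x from φ.symm_apply_apply x] at this
  have key : ∀ᶠ y in 𝓝 (φ x), ((φ * f * φ⁻¹) y : ℝ) = A' y := by
    filter_upwards [ht.eventually h, ht.eventually
      ((continuous_subtype_val.tendsto x).eventually h')] with y hy hy'
    rw [RelIso.mul_apply, RelIso.mul_apply, hφ, hy, hy', ← hφ,
      show φ (φ⁻¹ y) = y from φ.apply_symm_apply y]
  exact ⟨A', hA', A', hA', nhdsWithin_le_nhds key, nhdsWithin_le_nhds key, .inr rfl⟩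

/-- Conjugation by a map that is good off `U` and admissible on `U` takes elements of `F` that
fix `U` to elements of `F`. -/
lemma conj_mem_F {U : Finset ℝ} {Φ : ℝ ≃o ℝ} {φ f : I ≃o I} (hφ : ∀ x, (φ x : ℝ) = Φ x)
    (hadm : ∀ x, Admissible Φ x) (hgood : ∀ x : I, (x : ℝ) ∉ U → Good id Φ x) (hf : f ∈ F)
    (hfU : ∀ x : I, (x : ℝ) ∈ U → f x = x) : φ * f * φ⁻¹ ∈ F := by
  refine IsThompsonMap.of_good fun y => ?_
  obtain ⟨x, rfl⟩ := φ.surjective y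
  have hfx := IsThompsonMap.good hf x
  have generic : Good id Φ x → Good Subtype.val (φ * f * φ⁻¹) (φ x) := by
    intro h
    have hx : φ⁻¹ (φ x) = x := φ.symm_apply_apply x
    -- If `f x` lies in `U`, it is fixed by `f`, so `f x = x` by injectivity.
    have hfx' : Good id Φ (f x) := by
      by_cases hU : ((f x : I) : ℝ) ∈ U
      · rwa [f.injective (hfU _ hU)]
      · exact hgood _ hU
    refine Good.mul ?_ (h.restrict hφ).inv
    rw [hx]
    exact (hfx'.restrict hφ).mul hfx
  by_cases hU : (x : ℝ) ∈ U
  · rcases hadm x with h | ⟨h1, -, h3, -⟩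
    · exact generic h
    · exact good_conj_of_compat hφ h1 h3 hfx (hfU x hU)
  · exact generic (hgood x hU)

lemma Admissible.inv {Φ : ℝ ≃o ℝ} {x : ℝ} (h : Admissible Φ x) : Admissible Φ⁻¹ (Φ x) := by
  have hx : Φ⁻¹ (Φ x) = x := Φ.symm_apply_apply x
  rcases h with h | ⟨h1, h2, h3, h4⟩
  · exact .inl h.inv
  · exact .inr ⟨h2, by rwa [hx], h4, by rwa [hx, inv_inv]⟩

/-- The restriction to `[0,1]` of an automorphism of the line fixing `0` and `1`. -/
def restrictUnit (Φ : ℝ ≃o ℝ) (h0 : Φ 0 = 0) (h1 : Φ 1 = 1) : I ≃o I where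
  toFun x := ⟨Φ x, by rw [← h0]; exact Φ.monotone x.2.1, by
    conv_rhs => rw [← h1]
    exact Φ.monotone x.2.2⟩
  invFun x := ⟨Φ.symm x, by
    rw [← Φ.symm_apply_apply 0, h0]; exact Φ.symm.monotone x.2.1, by
    conv_rhs => rw [← Φ.symm_apply_apply 1, h1]
    exact Φ.symm.monotone x.2.2⟩
  left_inv x := by simp
  right_inv x := by simp
  map_rel_iff' {x y} := by simp [← Subtype.coe_le_coe]

lemma nonempty_mulEquiv_of_conj {U V : Finset ℝ} (φ : I ≃o I)
    (hUV : ∀ x : I, (x : ℝ) ∈ U ↔ (φ x : ℝ) ∈ V)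
    (h : ∀ f ∈ F, (∀ x : I, (x : ℝ) ∈ U → f x = x) → φ * f * φ⁻¹ ∈ F)
    (h' : ∀ f ∈ F, (∀ x : I, (x : ℝ) ∈ V → f x = x) → φ⁻¹ * f * φ ∈ F) :
    Nonempty (H U ≃* H V) := by
  have e1 : ∀ x, φ (φ⁻¹ x) = x := φ.apply_symm_apply
  have e2 : ∀ x, φ⁻¹ (φ x) = x := φ.symm_apply_apply
  refine ⟨⟨⟨fun f => ⟨⟨φ * f.1.1 * φ⁻¹, h _ f.1.2 f.2⟩, fun x hx => ?_⟩,
    fun f => ⟨⟨φ⁻¹ * f.1.1 * φ, h' _ f.1.2 f.2⟩, fun x hx => ?_⟩, fun f => ?_, fun f => ?_⟩,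
    fun f g => ?_⟩⟩
  · have hx' := f.2 (φ⁻¹ x) ((hUV _).2 (by rwa [e1]))
    simp only [RelIso.mul_apply]
    rw [hx', e1]
  · have hx' := f.2 (φ x) ((hUV x).1 hx)
    simp only [RelIso.mul_apply]
    rw [hx', e2]
  · apply Subtype.ext; apply Subtype.ext
    simp [mul_assoc]
  · apply Subtype.ext; apply Subtype.ext
    simp [mul_assoc]
  · apply Subtype.ext; apply Subtype.ext
    simp [mul_assoc]

/-- Adjoining 0 and 1 to both lists forces the interpolating map to fix them and so to restrict to
[0,1]. -/
lemma pairwise_lt_sort_unit {U : Finset ℝ} (hU : (U : Set ℝ) ⊆ Set.Ioo 0 1) :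
    (0 :: (U.sort (· ≤ ·) ++ [1])).Pairwise (· < ·) := by
  rw [List.pairwise_cons, List.pairwise_append]
  refine ⟨fun x hx => ?_, U.sortedLT_sort.pairwise, List.pairwise_singleton _ _, fun x hx y hy => ?_⟩
  · rcases List.mem_append.1 hx with hx | hx
    · exact (hU (by simpa using hx)).1
    · rw [List.mem_singleton.1 hx]
      exact one_pos
  · rw [List.mem_singleton.1 hy]
    exact (hU (by simpa using hx)).2

/-- Finite subsets of `(0,1)` of the same type have isomorphic stabilizers. -/
theorem nonempty_mulEquiv_of_type_eq (U V : Finset ℝ)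
    (hU : (U : Set ℝ) ⊆ Set.Ioo 0 1) (hV : (V : Set ℝ) ⊆ Set.Ioo 0 1)
    (hτ : τ U = τ V) : Nonempty (H U ≃* H V) := by
  obtain ⟨Φ, hΦ, hadm, hgood⟩ := exists_admissible_of_map_letter_eq _ _ (pairwise_lt_sort_unit hU)
    (pairwise_lt_sort_unit hV) (by simpa [τ] using hτ)
  simp only [List.map_cons, List.map_append, List.map_nil, List.cons.injEq] at hΦ
  obtain ⟨h0, hΦ⟩ := hΦ
  obtain ⟨hUV, h1⟩ := List.append_inj' hΦ rfl
  have h1 : Φ 1 = 1 := by simpa using h1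
  set φ := restrictUnit Φ h0 h1
  have hφ : ∀ x, (φ x : ℝ) = Φ x := fun _ => rfl
  have hφ' : ∀ x, ((φ⁻¹ : I ≃o I) x : ℝ) = Φ⁻¹ x := fun _ => rfl
  have hmem : ∀ x, x ∈ U ↔ Φ x ∈ V := by
    intro x
    rw [← Finset.mem_sort (· ≤ ·), ← Finset.mem_sort (s := V) (· ≤ ·), ← hUV,
      List.mem_map_of_injective Φ.injective]
  have e1 : ∀ x, Φ (Φ⁻¹ x) = x := Φ.apply_symm_apply
  -- The adjoined points 0 and 1 are dyadic, where admissible means good.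
  have hg : ∀ x ∉ U, Good id Φ x := by
    intro x hx
    by_cases hd : IsDyadic x
    · exact (hadm x).resolve_right fun h => h.1 hd
    · refine hgood x fun hm => ?_
      simp only [List.mem_cons, List.mem_append, Finset.mem_sort, hx, List.not_mem_nil, or_false,
        false_or] at hm
      rcases hm with rfl | rfl
      · exact hd isDyadic_zero
      · exact hd ⟨1, 0, by simp⟩
  refine nonempty_mulEquiv_of_conj φ (fun x => hmem x) (fun f hf hfU => ?_) (fun f hf hfV => ?_)
  · exact conj_mem_F hφ hadm (fun x hx => hg x hx) hf hfU
  · have := conj_mem_F (U := V) hφ' (fun x => by rw [← e1 x]; exact (hadm _).inv) (fun x hx => ?_)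
      hf hfV
    · rwa [inv_inv] at this
    · have hx' := hg (Φ⁻¹ x) (by rwa [hmem, e1])
      simpa only [e1] using hx'.inv

end Thompson

theorem mainTheorem1 (U V : Finset ℝ)
    (hU : (U : Set ℝ) ⊆ Set.Ioo 0 1) (hV : (V : Set ℝ) ⊆ Set.Ioo 0 1)
    (hτ : Thompson.τ U = Thompson.τ V) :
    Nonempty (Thompson.H U ≃* Thompson.H V) :=
  Thompson.nonempty_mulEquiv_of_type_eq U V hU hV hτ
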